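/- Two bidders compete for one item. Their values $v_1,v_2$ are independent and uniform on $[0,1]$, and bidder $i$ bids $b_i=B_i(v_i)$ for a bidding strategy $B_i$. The seller runs the Myerson mechanism for the distributions of the bids $B_1(v_1),B_2(v_2)$, as if the bids were the true values. That is, each bid $b_i$ is turned into its virtual value $g_i(b_i)$ for the bid distribution of bidder $i$, the item goes to the bidder with the highest virtual value provided that it is positive (it stays unsold in case of a tie), and the winner pays the least bid with which he would still win, while a loser pays nothing. Here, if the bid distribution has distribution function $F_i$ and density $f_i$ and is regular (i.e. the following expression is nondecreasing in $b$), then $g_i(b)=b-\frac{1-F_i(b)}{f_i(b)}$; for a general bid distribution $\mu_i$, $g_i(b)$ is Myerson's ironed virtual value, the right derivative at $q=\mu_i((b,\infty))$ of the least (closed) concave majorant of the revenue points $\big(\mu_i([x,\infty)),\,x\,\mu_i([x,\infty))\big)$, $x\in\mathbb R$ (and $-\infty$ at $q=1$). The utility of bidder $i$ is $U_i(B_1,B_2)=\mathbb E[a_iv_i-p_i]$, where $a_i\in\{0,1\}$ says whether $i$ receives the item and $p_i$ is the payment of $i$. This defines the induced game between the two bidders; a Nash equilibrium is meant in pure strategies.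 (1) If both bidders are restricted to the linear shading strategies $B(v)=\alpha v$, $\alpha\ge 0$, then the induced game has exactly one Nash equilibrium, namely $B_1(v)=B_2(v)=\frac{5}{14}v$. (2) If both bidders may use arbitrary monotone increasing (nondecreasing) strategies $B:[0,1]\to\mathbb R$, then $B_1(v)=B_2(v)=\frac{v+1}{4}$ is a Nash equilibrium of the induced game. -/

import Mathlib

open MeasureTheory

namespace InducedAuction

/-- The uniform distribution `U[0,1]` of a bidder's value. -/
noncomputable def uniform01 : Measure ℝ := volume.restrict (Set.Icc 0 1)

/-- The distribution of the bid `B v` when `v ∼ U[0,1]`, i.e. the distribution that a bidder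
with bidding strategy `B` reports to the seller. -/
noncomputable def bidLaw (B : ℝ → ℝ) : Measure ℝ := uniform01.map B

/-- The ironed revenue curve of a bid distribution `μ` at the sale probability `q`.
A posted price `b` sells with probability `μ [b, ∞)` and has revenue `b * μ [b, ∞)`; the ironed
curve is the least concave (closed) majorant of these points, that is the infimum of all affine
functions that lie above them. -/
noncomputable def ironedRevenue (μ : Measure ℝ) (q : ℝ) : ℝ :=
  sInf {y : ℝ | ∃ a c : ℝ, (∀ b : ℝ, b * μ.real (Set.Ici b) ≤ a + c * μ.real (Set.Ici b)) ∧
    y = a + c * q}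

/-- Myerson's (ironed) virtual value of the bid `b` for the bid distribution `μ`: the right
derivative of the ironed revenue curve at `q = μ (b, ∞) = 1 - F b`. For a concave curve this is
the supremum of the slopes of its chords to the right of `q`; it is `-∞` at `q = 1`, i.e. for
bids below the support of `μ`. If `μ` has a density `f` and `b - (1 - F b) / f b` is monotone, it
equals `b - (1 - F b) / f b`, see `virtualValue_eq_of_regular`. -/
noncomputable def virtualValue (μ : Measure ℝ) (b : ℝ) : EReal :=
  ⨆ t ∈ Set.Ioc (μ.real (Set.Ioi b)) 1,
    (((ironedRevenue μ t - ironedRevenue μ (μ.real (Set.Ioi b))) /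
      (t - μ.real (Set.Ioi b)) : ℝ) : EReal)

/-- For a regular distribution the virtual value is `b - (1 - F b) / f b`. -/
theorem virtualValue_eq_of_regular (μ : Measure ℝ) [IsProbabilityMeasure μ]
    (f : ℝ → ℝ) (l u : ℝ) (hc : Continuous fun x => ProbabilityTheory.cdf μ x)
    (hl : ProbabilityTheory.cdf μ l = 0) (hu : ProbabilityTheory.cdf μ u = 1)
    (hf : ∀ b ∈ Set.Ioo l u, HasDerivAt (fun x => ProbabilityTheory.cdf μ x) (f b) b ∧ 0 < f b)
    (hreg : MonotoneOn (fun b => b - (1 - ProbabilityTheory.cdf μ b) / f b) (Set.Ioo l u))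
    (b : ℝ) (hb : b ∈ Set.Ioo l u) :
    virtualValue μ b = ((b - (1 - ProbabilityTheory.cdf μ b) / f b : ℝ) : EReal) := by
  set F : ℝ → ℝ := fun x => ProbabilityTheory.cdf μ x with hF
  have hFm : Monotone F := ProbabilityTheory.monotone_cdf μ
  have hsing : ∀ x, μ {x} = 0 := by
    intro x
    have h := (ProbabilityTheory.cdf μ).measure_singleton x
    rw [ProbabilityTheory.measure_cdf] at h
    have h2 : Function.leftLim (ProbabilityTheory.cdf μ) x = ProbabilityTheory.cdf μ x :=
      hc.continuousAt.continuousWithinAt.leftLim_eq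
    rw [h, h2]; simp
  have hIoi : ∀ x, μ.real (Set.Ioi x) = 1 - F x := by
    intro x
    have h := probReal_compl_eq_one_sub (μ := μ) (measurableSet_Iic (a := x))
    rw [Set.compl_Iic] at h
    simp only [h, hF, ProbabilityTheory.cdf_eq_real]
  have hIci : ∀ x, μ.real (Set.Ici x) = 1 - F x := by
    intro x
    have h : μ (Set.Ici x) = μ (Set.Ioi x) := by
      rw [← Set.Ioi_union_left]
      exact le_antisymm ((measure_union_le _ _).trans (by simp [hsing]))
        (measure_mono Set.subset_union_left)
    rw [← hIoi x, Measure.real, Measure.real, h]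
  set g : ℝ := b - (1 - F b) / f b with hg
  have hfb : 0 < f b := (hf b hb).2
  -- `b` maximises `(x - g) (1 - F x)`
  have hder : ∀ x ∈ Set.Ioo l u, HasDerivAt (fun x => (x - g) * (1 - F x))
      (-(f x) * ((x - (1 - F x) / f x) - g)) x := by
    intro x hx
    have h1 := ((hasDerivAt_id x).sub_const g).mul ((hf x hx).1.const_sub 1)
    have h2 := (hf x hx).2
    refine h1.congr_deriv ?_
    have h3 : f x * ((1 - F x) / f x) = 1 - F x := by field_simp
    simp only [id]
    linear_combination -h3
  have hcont : Continuous fun x => (x - g) * (1 - F x) := by fun_prop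
  have hmono : MonotoneOn (fun x => (x - g) * (1 - F x)) (Set.Icc l b) := by
    refine monotoneOn_of_deriv_nonneg (convex_Icc _ _) hcont.continuousOn ?_ ?_
    · intro x hx
      rw [interior_Icc] at hx
      exact (hder x ⟨hx.1, hx.2.trans hb.2⟩).differentiableAt.differentiableWithinAt
    · intro x hx
      rw [interior_Icc] at hx
      have hx' : x ∈ Set.Ioo l u := ⟨hx.1, hx.2.trans hb.2⟩
      rw [(hder x hx').deriv]
      have h1 := hreg hx' hb hx.2.le
      have h2 := (hf x hx').2
      simp only at h1
      nlinarith [mul_nonneg h2.le (sub_nonneg.2 h1)]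
  have hanti : AntitoneOn (fun x => (x - g) * (1 - F x)) (Set.Icc b u) := by
    refine antitoneOn_of_deriv_nonpos (convex_Icc _ _) hcont.continuousOn ?_ ?_
    · intro x hx
      rw [interior_Icc] at hx
      exact (hder x ⟨hb.1.trans hx.1, hx.2⟩).differentiableAt.differentiableWithinAt
    · intro x hx
      rw [interior_Icc] at hx
      have hx' : x ∈ Set.Ioo l u := ⟨hb.1.trans hx.1, hx.2⟩
      rw [(hder x hx').deriv]
      have h1 := hreg hb hx' hx.1.le
      have h2 := (hf x hx').2
      simp only at h1
      nlinarith [mul_nonneg h2.le (sub_nonneg.2 h1)]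
  have hFl : F l = 0 := hl
  have hFu : F u = 1 := hu
  have hmax : ∀ x, (x - g) * (1 - F x) ≤ (b - g) * (1 - F b) := by
    intro x
    rcases le_total x l with h | h
    · have h0 : F x = 0 := le_antisymm (hFl ▸ hFm h) (ProbabilityTheory.cdf_nonneg μ x)
      have h1 := hmono ⟨le_rfl, hb.1.le⟩ ⟨hb.1.le, le_rfl⟩ hb.1.le
      simp only [hFl] at h1
      rw [h0]; linarith
    rcases le_total u x with h' | h'
    · have h0 : F x = 1 := le_antisymm (ProbabilityTheory.cdf_le_one μ x) (hFu ▸ hFm h')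
      have h1 := hanti ⟨le_rfl, hb.2.le⟩ ⟨hb.2.le, le_rfl⟩ hb.2.le
      simp only [hFu] at h1
      rw [h0]; linarith
    rcases le_total x b with h2 | h2
    · exact hmono ⟨h, h2⟩ ⟨hb.1.le, le_rfl⟩ h2
    · exact hanti ⟨le_rfl, hb.2.le⟩ ⟨h2, h'⟩ h2
  -- the ironed revenue curve: tangent above, the curve itself below
  have hup : ∀ q, 0 ≤ q → ∀ x, q = 1 - F x →
      x * q ≤ ironedRevenue μ q := by
    intro q _ x hq
    refine le_csInf ⟨_, (b - g) * (1 - F b), g, fun y => ?_, rfl⟩ ?_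
    · rw [hIci]; linarith [hmax y]
    · rintro y ⟨a, c, h, rfl⟩
      have := h x
      rwa [hIci, ← hq] at this
  have hF1 : ∀ x, F x ≤ 1 := ProbabilityTheory.cdf_le_one μ
  have hlo : ∀ q ∈ Set.Icc (0 : ℝ) 1,
      ironedRevenue μ q ≤ (b - g) * (1 - F b) + g * q := by
    intro q hq
    refine csInf_le ?_ ⟨_, g, fun y => ?_, rfl⟩
    · -- bounded below by the chord between the end points
      refine ⟨min 0 l, ?_⟩
      rintro y ⟨a, c, h, rfl⟩
      have h1 := h l
      have h2 := h u
      rw [hIci, hFl] at h1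
      rw [hIci, hFu] at h2
      have := min_le_left 0 l
      have := min_le_right 0 l
      nlinarith [hq.1, hq.2]
    · rw [hIci]; linarith [hmax y]
  have hFb1 : 0 ≤ F b := ProbabilityTheory.cdf_nonneg μ b
  have hRb : ironedRevenue μ (1 - F b) = b * (1 - F b) := by
    refine le_antisymm ?_ (hup _ (by linarith [hF1 b]) b rfl)
    have := hlo (1 - F b) ⟨by linarith [hF1 b], by linarith⟩
    linarith
  unfold virtualValue
  rw [hIoi, hRb]
  refine le_antisymm (iSup₂_le fun t ht => ?_) ?_
  · have h1 := hlo t ⟨by linarith [hF1 b, ht.1], ht.2⟩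
    have h2 : 0 < t - (1 - F b) := by linarith [ht.1]
    rw [EReal.coe_le_coe_iff, div_le_iff₀ h2]
    linarith
  · -- chords from `b` to `x < b`, with `x → b`
    have hlim : Filter.Tendsto (fun x => (x * (1 - F x) - b * (1 - F b)) / ((1 - F x) - (1 - F b)))
        (nhdsWithin b (Set.Iio b)) (nhds g) := by
      have e1 : HasDerivAt (fun x => x * (1 - F x)) (1 * (1 - F b) + b * -(f b)) b :=
        (hasDerivAt_id b).mul ((hf b hb).1.const_sub 1)
      have e2 : HasDerivAt (fun x => 1 - F x) (-(f b)) b := (hf b hb).1.const_sub 1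
      have t1 := (hasDerivAt_iff_tendsto_slope.1 e1).mono_left
        (nhdsWithin_mono b (fun x hx => ne_of_lt hx : Set.Iio b ⊆ {b}ᶜ))
      have t2 := (hasDerivAt_iff_tendsto_slope.1 e2).mono_left
        (nhdsWithin_mono b (fun x hx => ne_of_lt hx : Set.Iio b ⊆ {b}ᶜ))
      have t3 := t1.div t2 (neg_ne_zero.2 hfb.ne')
      have hgv : (1 * (1 - F b) + b * -(f b)) / -(f b) = g := by
        rw [hg]; field_simp; ring
      rw [hgv] at t3
      refine t3.congr' ?_
      filter_upwards [self_mem_nhdsWithin] with x hx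
      have hx' : x - b ≠ 0 := sub_ne_zero.2 (ne_of_lt hx)
      simp only [Pi.div_apply, slope_def_field]
      rw [div_div_div_cancel_right₀ hx']
    have hlim' := (continuous_coe_real_ereal.tendsto g).comp hlim
    refine le_of_tendsto hlim' ?_
    have hmem : Set.Ioo l b ∈ nhdsWithin b (Set.Iio b) := Ioo_mem_nhdsLT hb.1
    filter_upwards [hmem] with x hx
    have hlt : F x < F b := by
      have : StrictMonoOn F (Set.Icc x b) := by
        refine strictMonoOn_of_deriv_pos (convex_Icc _ _) hc.continuousOn ?_
        intro y hy
        rw [interior_Icc] at hy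
        have h := hf y ⟨hx.1.trans hy.1, hy.2.trans hb.2⟩
        rw [h.1.deriv]; exact h.2
      exact this ⟨le_rfl, hx.2.le⟩ ⟨hx.2.le, le_rfl⟩ hx.2
    have hFx : 0 ≤ F x := ProbabilityTheory.cdf_nonneg μ x
    refine le_trans ?_ (le_iSup₂ (f := fun (t : ℝ) (_ : t ∈ Set.Ioc (1 - F b) 1) =>
      (((ironedRevenue μ t - b * (1 - F b)) / (t - (1 - F b)) : ℝ) : EReal)) (1 - F x)
      ⟨by linarith, by linarith⟩)
    simp only [Function.comp]
    rw [EReal.coe_le_coe_iff]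
    have h2 : 0 < (1 - F x) - (1 - F b) := by linarith
    have h3 := hup (1 - F x) (by linarith [hF1 x]) x rfl
    gcongr

section Mechanism

variable {ι : Type*} [DecidableEq ι]

/-- Given the reported bid distributions `μ` and the bids `b`, bidder `i` receives the item iff
`i` has the highest virtual value and this value is positive. -/
def Wins (μ : ι → Measure ℝ) (b : ι → ℝ) (i : ι) : Prop :=
  0 < virtualValue (μ i) (b i) ∧
    ∀ j, j ≠ i → virtualValue (μ j) (b j) < virtualValue (μ i) (b i)

open Classical in
/-- The allocation `a_i ∈ {0, 1}` of the Myerson mechanism. -/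
noncomputable def allocation (μ : ι → Measure ℝ) (b : ι → ℝ) (i : ι) : ℝ :=
  if Wins μ b i then 1 else 0

open Classical in
/-- The payment of the Myerson mechanism: the winner pays the least bid with which he would
still win against the bids of the others, a loser pays nothing. -/
noncomputable def payment (μ : ι → Measure ℝ) (b : ι → ℝ) (i : ι) : ℝ :=
  if Wins μ b i then sInf {x : ℝ | Wins μ (Function.update b i x) i} else 0

/-- The utility of bidder `i` in the induced game when the bidders use the bidding strategies `B`:
the expectation of `a_i v_i - p_i` over independent `U[0,1]` values, where the seller runs the
Myerson mechanism for the bid distributions as if they were the value distributions. -/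
noncomputable def utility [Fintype ι] (B : ι → ℝ → ℝ) (i : ι) : ℝ :=
  ∫ v : ι → ℝ,
      (allocation (fun j => bidLaw (B j)) (fun j => B j (v j)) i * v i
        - payment (fun j => bidLaw (B j)) (fun j => B j (v j)) i)
    ∂(Measure.pi fun _ : ι => uniform01)

/-- Nash equilibrium (in pure strategies) of the induced game in which every bidder chooses a
bidding strategy from `A`. -/
def IsNashEquilibrium [Fintype ι] (A : Set (ℝ → ℝ)) (B : ι → ℝ → ℝ) : Prop :=
  (∀ i, B i ∈ A) ∧
    ∀ i, ∀ B' ∈ A, utility (Function.update B i B') i ≤ utility B i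

end Mechanism

/-- The linear shading strategies `B v = α v`. -/
def linearShading : Set (ℝ → ℝ) := {B | ∃ α : ℝ, 0 ≤ α ∧ B = fun v => α * v}

/-- The monotone increasing strategies on the value space `[0,1]`. -/
def monotoneStrategies : Set (ℝ → ℝ) := {B | MonotoneOn B (Set.Icc 0 1)}

end InducedAuction

/-! Each bidder faces a threshold: the larger of zero and the rival's virtual value (`utility_eq`).
By duality between the ironed curve and posted prices, the bids whose virtual value exceeds `m` form
a half-line starting at a price `p` that maximises the profit `(x - m) * μ [x, ∞)`, and `p` is what
the winner pays (`exists_threshold`).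

Monotone strategies: a rival who bids `(w + 1) / 4` creates the threshold `w / 2`. If `k w` is the
winning probability and `h w` the maximal profit at cost `w / 2`, the expected utility given `w` is
at most `(1 - w) ^ 2 / 2 + w / 2 * k w - h w` (`integral_payoff_le`): the bidder would like to win
exactly when `v > w`. The envelope formula gives `h' = -k / 2`, so integration by parts yields `∫ w
/ 2 * k ≤ ∫ h`; `integral_le_of_scaling` does this without derivatives. Hence every monotone
strategy earns at most `∫ (1 - w) ^ 2 / 2 = 1 / 6`, and `(v + 1) / 4` attains it
(`utility_quarter`).

Linear shading: virtual values are affine in the values, which gives the closed form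
`linearUtility`, with one branch on each side of `α = β`. First-order conditions on the two branches
are incompatible when the factors differ (`not_lt_of_bestResponses`), and on the diagonal they force
`5 / 14` (`eq_of_bestResponse_self`). Conversely, `linearUtility_le_equilibrium` verifies global
optimality. -/

namespace InducedAuction

/-! ### Ironed revenue curves and optimal posted prices -/

section Ironing

variable {μ : Measure ℝ} {l u : ℝ}

/-- The prices `l` and `u + 1` have revenue points `(1, l)` and `(0, 0)`, and a majorant lies above
their chord. This bounds from below the set whose infimum is `ironedRevenue`. -/
theorem le_of_majorant (hl : μ.real (Set.Ici l) = 1) (hu : ∀ x, u < x → μ.real (Set.Ici x) = 0)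
    {q a c : ℝ} (hq : q ∈ Set.Icc (0 : ℝ) 1)
    (h : ∀ b : ℝ, b * μ.real (Set.Ici b) ≤ a + c * μ.real (Set.Ici b)) : q * l ≤ a + c * q := by
  have h1 := h l
  have h2 := h (u + 1)
  rw [hl] at h1
  rw [hu (u + 1) (by linarith)] at h2
  nlinarith [hq.1, hq.2]

/-- An affine function above the revenue points lies above the ironed revenue curve. -/
theorem ironedRevenue_le (hl : μ.real (Set.Ici l) = 1) (hu : ∀ x, u < x → μ.real (Set.Ici x) = 0)
    {q a c : ℝ} (hq : q ∈ Set.Icc (0 : ℝ) 1)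
    (h : ∀ b : ℝ, b * μ.real (Set.Ici b) ≤ a + c * μ.real (Set.Ici b)) :
    ironedRevenue μ q ≤ a + c * q := by
  refine csInf_le ⟨q * l, ?_⟩ ⟨a, c, h, rfl⟩
  rintro y ⟨a', c', h', rfl⟩
  exact le_of_majorant hl hu hq h'

theorem exists_majorant (hu : ∀ x, u < x → μ.real (Set.Ici x) = 0) :
    ∃ a c : ℝ, ∀ b : ℝ, b * μ.real (Set.Ici b) ≤ a + c * μ.real (Set.Ici b) := by
  refine ⟨0, u, fun b => ?_⟩
  rcases lt_or_ge u b with hb | hb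
  · simp [hu b hb]
  · rw [zero_add]
    exact mul_le_mul_of_nonneg_right hb measureReal_nonneg

theorem le_ironedRevenue_iff (hl : μ.real (Set.Ici l) = 1)
    (hu : ∀ x, u < x → μ.real (Set.Ici x) = 0)
    {q y : ℝ} (hq : q ∈ Set.Icc (0 : ℝ) 1) :
    y ≤ ironedRevenue μ q ↔
      ∀ a c : ℝ, (∀ b : ℝ, b * μ.real (Set.Ici b) ≤ a + c * μ.real (Set.Ici b)) →
        y ≤ a + c * q := by
  constructor
  · intro h a c hac
    exact h.trans (ironedRevenue_le hl hu hq hac)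
  · intro h
    obtain ⟨a, c, hac⟩ := exists_majorant hu
    refine le_csInf ⟨_, a, c, hac, rfl⟩ ?_
    rintro z ⟨a', c', h', rfl⟩
    exact h a' c' h'

variable [IsProbabilityMeasure μ]

theorem measureReal_Ici_antitone (μ : Measure ℝ) [IsProbabilityMeasure μ] :
    Antitone fun x => μ.real (Set.Ici x) :=
  fun _ _ h => measureReal_mono (Set.Ici_subset_Ici.2 h)

theorem measureReal_mem_Icc (s : Set ℝ) : μ.real s ∈ Set.Icc (0 : ℝ) 1 :=
  ⟨measureReal_nonneg, measureReal_le_one⟩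

theorem le_ironedRevenue (hl : μ.real (Set.Ici l) = 1)
    (hu : ∀ x, u < x → μ.real (Set.Ici x) = 0) (x : ℝ) :
    x * μ.real (Set.Ici x) ≤ ironedRevenue μ (μ.real (Set.Ici x)) :=
  (le_ironedRevenue_iff hl hu (measureReal_mem_Icc _)).2 fun _ _ h => h x

/-- If the price `p` maximises `(x - m) * μ [x, ∞)`, then the bids below `p` have virtual value
at most `m`. -/
theorem virtualValue_le_of_isMax (hl : μ.real (Set.Ici l) = 1)
    (hu : ∀ x, u < x → μ.real (Set.Ici x) = 0) {m p y : ℝ}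
    (hp : ∀ x, (x - m) * μ.real (Set.Ici x) ≤ (p - m) * μ.real (Set.Ici p))
    (hy : μ.real (Set.Ici p) ≤ μ.real (Set.Ioi y)) : virtualValue μ y ≤ (m : EReal) := by
  unfold virtualValue
  refine iSup₂_le fun t ht => ?_
  set q := μ.real (Set.Ioi y)
  set r := μ.real (Set.Ici p)
  have hq : q ∈ Set.Icc (0 : ℝ) 1 := measureReal_mem_Icc _
  have hr : r ∈ Set.Icc (0 : ℝ) 1 := measureReal_mem_Icc _
  have htq : 0 < t - q := sub_pos.2 ht.1
  rw [EReal.coe_le_coe_iff, div_le_iff₀ htq, sub_le_iff_le_add, add_comm, ← sub_le_iff_le_add,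
    le_ironedRevenue_iff hl hu hq]
  intro a c hac
  have ht' : t ∈ Set.Icc (0 : ℝ) 1 := ⟨hq.1.trans ht.1.le, ht.2⟩
  have h1 : ironedRevenue μ t ≤ a + c * t := ironedRevenue_le hl hu ht' hac
  have h2 : ironedRevenue μ t ≤ (p - m) * r + m * t :=
    ironedRevenue_le hl hu ht' fun b => by linarith [hp b]
  have h3 : p * r ≤ a + c * r := hac p
  -- A majorant of slope at most `m` rises by at most `m * (t - q)`. A steeper one, being above the
  -- line of slope `m` through `(r, p * r)` at `r ≤ q`, is still above it at `q`, and that line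
  -- bounds the curve at `t`.
  rcases le_total c m with h | h
  · nlinarith [mul_nonneg (sub_nonneg.2 h) htq.le]
  · nlinarith [mul_nonneg (sub_nonneg.2 h) (sub_nonneg.2 hy)]

/-- If `p` is the largest price that maximises `(x - m) * μ [x, ∞)`, and smaller sale
probabilities are uniformly worse, then the bids above `p` have virtual value above `m`. -/
theorem lt_virtualValue_of_gap (hl : μ.real (Set.Ici l) = 1)
    (hu : ∀ x, u < x → μ.real (Set.Ici x) = 0) {m p y : ℝ}
    (hp : ∀ x, (x - m) * μ.real (Set.Ici x) ≤ (p - m) * μ.real (Set.Ici p))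
    (hgap : ∀ q < μ.real (Set.Ici p), ∃ δ > 0, ∀ x, μ.real (Set.Ici x) ≤ q →
      (x - m) * μ.real (Set.Ici x) ≤ (p - m) * μ.real (Set.Ici p) - δ)
    (hy : μ.real (Set.Ioi y) < μ.real (Set.Ici p)) : (m : EReal) < virtualValue μ y := by
  set q := μ.real (Set.Ioi y) with hqdef
  set r := μ.real (Set.Ici p) with hrdef
  have hq : q ∈ Set.Icc (0 : ℝ) 1 := measureReal_mem_Icc _
  have hr : r ∈ Set.Icc (0 : ℝ) 1 := measureReal_mem_Icc _
  obtain ⟨δ, hδ, hgap⟩ := hgap ((q + r) / 2) (by linarith)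
  -- The supporting line of slope `m` is tilted to slope `m + δ` about the midpoint of `q` and `r`.
  -- It stays a majorant because, left of the midpoint, it drops by at most `δ`. So the curve at `q`
  -- is strictly below the supporting line, and the chord to `r` is steeper than `m`.
  have h1 : ironedRevenue μ q ≤ ((p - m) * r - δ * ((q + r) / 2)) + (m + δ) * q := by
    refine ironedRevenue_le hl hu hq fun b => ?_
    have hb : μ.real (Set.Ici b) ∈ Set.Icc (0 : ℝ) 1 := measureReal_mem_Icc _
    rcases le_total (μ.real (Set.Ici b)) ((q + r) / 2) with h | h
    · nlinarith [hgap b h, hb.1, hr.2, hq.2, mul_nonneg hδ.le hb.1,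
        mul_nonneg hδ.le (sub_nonneg.2 hr.2), mul_nonneg hδ.le (sub_nonneg.2 hq.2)]
    · nlinarith [hp b, mul_nonneg hδ.le (sub_nonneg.2 h)]
  have h2 : p * r ≤ ironedRevenue μ r := le_ironedRevenue hl hu p
  unfold virtualValue
  refine lt_of_lt_of_le ?_ (le_iSup₂ (f := fun (t : ℝ) (_ : t ∈ Set.Ioc q 1) =>
      (((ironedRevenue μ t - ironedRevenue μ q) / (t - q) : ℝ) : EReal)) r ⟨hy, hr.2⟩)
  rw [EReal.coe_lt_coe_iff, lt_div_iff₀ (sub_pos.2 hy)]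
  nlinarith [mul_pos hδ (sub_pos.2 hy)]

/-- The largest profit `(x - m) * μ [x, ∞)` of a posted price against the cost `m`. -/
noncomputable def maxProfit (μ : Measure ℝ) (m : ℝ) : ℝ :=
  ⨆ x : ℝ, (x - m) * μ.real (Set.Ici x)

theorem profit_bddAbove (hu : ∀ x, u < x → μ.real (Set.Ici x) = 0) (m : ℝ) :
    BddAbove (Set.range fun x : ℝ => (x - m) * μ.real (Set.Ici x)) := by
  refine ⟨max (u - m) 0, ?_⟩
  rintro _ ⟨x, rfl⟩
  have hx : μ.real (Set.Ici x) ∈ Set.Icc (0 : ℝ) 1 := measureReal_mem_Icc _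
  rcases lt_or_ge u x with h | h
  · simp [hu x h]
  · calc (x - m) * μ.real (Set.Ici x) ≤ max (u - m) 0 * μ.real (Set.Ici x) :=
        mul_le_mul_of_nonneg_right (le_max_of_le_left (by linarith)) hx.1
      _ ≤ max (u - m) 0 := mul_le_of_le_one_right (le_max_right _ _) hx.2

theorem le_maxProfit (hu : ∀ x, u < x → μ.real (Set.Ici x) = 0) (m x : ℝ) :
    (x - m) * μ.real (Set.Ici x) ≤ maxProfit μ m :=
  le_ciSup (profit_bddAbove hu m) x

theorem maxProfit_nonneg (hu : ∀ x, u < x → μ.real (Set.Ici x) = 0) (m : ℝ) :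
    0 ≤ maxProfit μ m := by
  simpa [hu (u + 1) (by linarith)] using le_maxProfit hu m (u + 1)

theorem maxProfit_antitone (hu : ∀ x, u < x → μ.real (Set.Ici x) = 0) :
    Antitone (maxProfit μ) := fun m m' h =>
  ciSup_mono (profit_bddAbove hu m) fun x =>
    mul_le_mul_of_nonneg_right (by linarith) measureReal_nonneg

theorem tendsto_measureReal_Ici_left (μ : Measure ℝ) [IsProbabilityMeasure μ] (x : ℝ) :
    Filter.Tendsto (fun n : ℕ => μ.real (Set.Ici (x - 1 / ((n : ℝ) + 1)))) Filter.atTop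
      (nhds (μ.real (Set.Ici x))) := by
  have hI : (⋂ n : ℕ, Set.Ici (x - 1 / ((n : ℝ) + 1))) = Set.Ici x := by
    ext y
    simp only [Set.mem_iInter, Set.mem_Ici]
    constructor
    · intro h
      refine le_of_tendsto' (f := fun n : ℕ => x - 1 / ((n : ℝ) + 1)) (x := Filter.atTop) ?_ h
      simpa using tendsto_const_nhds.sub (tendsto_one_div_add_atTop_nhds_zero_nat (𝕜 := ℝ))
    · intro h n
      have : (0 : ℝ) < 1 / ((n : ℝ) + 1) := by positivity
      linarith
  have hanti : Antitone fun n : ℕ => Set.Ici (x - 1 / ((n : ℝ) + 1)) := by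
    intro a b hab
    refine Set.Ici_subset_Ici.2 ?_
    have : 1 / ((b : ℝ) + 1) ≤ 1 / ((a : ℝ) + 1) := Nat.one_div_le_one_div hab
    linarith
  have h := tendsto_measure_iInter_atTop (μ := μ)
    (fun n : ℕ => (measurableSet_Ici (a := x - 1 / ((n : ℝ) + 1))).nullMeasurableSet) hanti
    ⟨0, measure_ne_top _ _⟩
  rw [hI] at h
  exact (ENNReal.tendsto_toReal (measure_ne_top _ _)).comp h

/-- If a positive profit is possible, there is a largest optimal price, and higher prices are
uniformly worse when they stay away from it. -/
theorem exists_largest_optimal_price (hu : ∀ x, u < x → μ.real (Set.Ici x) = 0) {m : ℝ}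
    (hm : 0 < maxProfit μ m) :
    ∃ p, (p - m) * μ.real (Set.Ici p) = maxProfit μ m ∧
      ∀ y, p < y → ∃ δ > 0, ∀ x, y ≤ x →
        (x - m) * μ.real (Set.Ici x) ≤ maxProfit μ m - δ := by
  set H := maxProfit μ m with hH
  -- Prices from which on the profit stays uniformly below the optimum; the infimum of `D` is the
  -- price sought.
  set D : Set ℝ := {y | ∃ δ > 0, ∀ x, y ≤ x → (x - m) * μ.real (Set.Ici x) ≤ H - δ} with hD
  have hD1 : u + 1 ∈ D := ⟨H, hm, fun x hx => by rw [hu x (by linarith)]; simp⟩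
  have hlow : ∀ y ∈ D, m ≤ y := by
    rintro y ⟨δ, hδ, h⟩
    by_contra hy
    push Not at hy
    have : H ≤ max (H - δ) 0 := by
      refine ciSup_le fun x => ?_
      rcases le_total y x with hx | hx
      · exact le_max_of_le_left (h x hx)
      · exact le_max_of_le_right
          (mul_nonpos_of_nonpos_of_nonneg (by linarith) measureReal_nonneg)
    rcases le_max_iff.1 this with h | h <;> linarith
  have hbdd : BddBelow D := ⟨m, hlow⟩
  set p := sInf D with hp
  have habove : ∀ y, p < y → y ∈ D := by
    intro y hy
    obtain ⟨z, ⟨δ, hδ, hz⟩, hzy⟩ := exists_lt_of_csInf_lt ⟨_, hD1⟩ hy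
    exact ⟨δ, hδ, fun x hx => hz x (hzy.le.trans hx)⟩
  refine ⟨p, le_antisymm (le_maxProfit hu m p) ?_, habove⟩
  have hleft : ∀ y < p, H ≤ (p - m) * μ.real (Set.Ici y) := by
    intro y hy
    have hN : μ.real (Set.Ici y) ∈ Set.Icc (0 : ℝ) 1 := measureReal_mem_Icc _
    refine le_of_forall_pos_le_add fun ε hε => ?_
    obtain ⟨δ, hδ, hx⟩ := habove (p + ε / 2) (by linarith)
    have hnot : y ∉ D := fun h => absurd (csInf_le hbdd h) (not_le.2 hy)
    simp only [hD, Set.mem_ofPred_eq, not_exists, not_and, not_forall, not_le] at hnot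
    -- A loss below `δ` keeps `x` under `p + ε / 2`; a loss below `ε / 2` makes the total error at
    -- most `ε`.
    obtain ⟨x, hyx, hlt⟩ := hnot (min δ (ε / 2)) (lt_min hδ (by linarith))
    have h1 := min_le_left δ (ε / 2)
    have h2 := min_le_right δ (ε / 2)
    have hxp : x < p + ε / 2 := by
      by_contra h
      push Not at h
      linarith [hx x h]
    have hxN : μ.real (Set.Ici x) ∈ Set.Icc (0 : ℝ) 1 := measureReal_mem_Icc _
    have hmono : μ.real (Set.Ici x) ≤ μ.real (Set.Ici y) := measureReal_Ici_antitone μ hyx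
    have hpm : 0 ≤ p - m := sub_nonneg.2 (le_csInf ⟨_, hD1⟩ hlow)
    have h3 : (x - m) * μ.real (Set.Ici x) ≤ (p + ε / 2 - m) * μ.real (Set.Ici x) :=
      mul_le_mul_of_nonneg_right (by linarith) hxN.1
    have h4 : (p - m) * μ.real (Set.Ici x) ≤ (p - m) * μ.real (Set.Ici y) :=
      mul_le_mul_of_nonneg_left hmono hpm
    nlinarith [hxN.2]
  -- Left continuity of `x ↦ μ [x, ∞)` carries the bound from `y < p` to `p`.
  refine ge_of_tendsto' ((tendsto_measureReal_Ici_left μ p).const_mul (p - m)) fun n => ?_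
  refine hleft _ ?_
  have : (0 : ℝ) < 1 / ((n : ℝ) + 1) := by positivity
  linarith

/-- For every cost `m` the bids with virtual value above `m` start at an optimal posted price
`p` against the cost `m`, and have the mass `μ [p, ∞)`. -/
theorem exists_threshold (hl : μ.real (Set.Ici l) = 1)
    (hu : ∀ x, u < x → μ.real (Set.Ici x) = 0) (m : ℝ) :
    ∃ p, (p - m) * μ.real (Set.Ici p) = maxProfit μ m ∧
      MeasurableSet {x | (m : EReal) < virtualValue μ x} ∧
      μ.real {x | (m : EReal) < virtualValue μ x} = μ.real (Set.Ici p) ∧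
      ({x | (m : EReal) < virtualValue μ x}.Nonempty →
        sInf {x | (m : EReal) < virtualValue μ x} = p) := by
  set S := {x | (m : EReal) < virtualValue μ x} with hS
  rcases (maxProfit_nonneg hu m).eq_or_lt with h0 | h0
  -- Without a positive profit no bid has virtual value above `m`, and any price that never sells
  -- can serve as `p`.
  · have hN : μ.real (Set.Ici (u + 1)) = 0 := hu _ (by linarith)
    have hempty : S = ∅ := by
      refine Set.eq_empty_of_forall_notMem fun y hy => ?_
      refine absurd (virtualValue_le_of_isMax hl hu (m := m) (p := u + 1) (y := y) ?_ ?_)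
        (not_le.2 hy)
      · intro x
        rw [hN, mul_zero, h0]
        exact le_maxProfit hu m x
      · rw [hN]; exact measureReal_nonneg
    refine ⟨u + 1, by rw [hN, ← h0, mul_zero], ?_, ?_, ?_⟩
    · rw [hempty]; exact MeasurableSet.empty
    · rw [hempty, hN]; simp
    · rw [hempty]; simp
  obtain ⟨p, hp, hgap⟩ := exists_largest_optimal_price hu h0
  have hmax : ∀ x, (x - m) * μ.real (Set.Ici x) ≤ (p - m) * μ.real (Set.Ici p) := fun x => by
    rw [hp]; exact le_maxProfit hu m x
  have hN : 0 < μ.real (Set.Ici p) := by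
    refine lt_of_le_of_ne measureReal_nonneg fun h => ?_
    rw [← h, mul_zero] at hp
    linarith
  have hpm : 0 < p - m := pos_of_mul_pos_left (hp ▸ h0) hN.le
  have hgap' : ∀ q < μ.real (Set.Ici p), ∃ δ > 0, ∀ x, μ.real (Set.Ici x) ≤ q →
      (x - m) * μ.real (Set.Ici x) ≤ (p - m) * μ.real (Set.Ici p) - δ := by
    intro q hq
    -- The gap in prices becomes a gap in sale probabilities: prices just above `p`, or between `m`
    -- and `p`, that sell with probability at most `q` lose at least `γ / 2`.
    have hgp : 0 < (p - m) * (μ.real (Set.Ici p) - q) := mul_pos hpm (sub_pos.2 hq)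
    set γ := (p - m) * (μ.real (Set.Ici p) - q) with hγ
    obtain ⟨δ, hδ, h⟩ := hgap (p + γ / 2) (by linarith)
    have h1 := min_le_left δ (min (γ / 2) (maxProfit μ m))
    have h2 := (min_le_right δ (min (γ / 2) (maxProfit μ m))).trans (min_le_left _ _)
    have h3 := (min_le_right δ (min (γ / 2) (maxProfit μ m))).trans (min_le_right _ _)
    refine ⟨min δ (min (γ / 2) (maxProfit μ m)), lt_min hδ (lt_min (by linarith) h0),
      fun x hx => ?_⟩
    have hxN : μ.real (Set.Ici x) ∈ Set.Icc (0 : ℝ) 1 := measureReal_mem_Icc _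
    rcases le_or_gt (p + γ / 2) x with hxp | hxp
    · linarith [h x hxp]
    rcases le_total x m with hxm | hxm
    · have : (x - m) * μ.real (Set.Ici x) ≤ 0 :=
        mul_nonpos_of_nonpos_of_nonneg (by linarith) hxN.1
      linarith
    · have h4 : (x - m) * μ.real (Set.Ici x) ≤ (p + γ / 2 - m) * μ.real (Set.Ici x) :=
        mul_le_mul_of_nonneg_right (by linarith) hxN.1
      have h5 : (p - m) * μ.real (Set.Ici x) ≤ (p - m) * q :=
        mul_le_mul_of_nonneg_left hx hpm.le
      nlinarith [hxN.2]
  have hSiff : ∀ y, y ∈ S ↔ μ.real (Set.Ioi y) < μ.real (Set.Ici p) := by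
    intro y
    refine ⟨fun hy => ?_, fun hy => lt_virtualValue_of_gap hl hu hmax hgap' hy⟩
    by_contra h
    exact absurd (virtualValue_le_of_isMax hl hu hmax (not_lt.1 h)) (not_le.2 hy)
  have hIoi : Set.Ioi p ⊆ S := by
    intro y hy
    rw [hSiff]
    have h1 : μ.real (Set.Ioi y) ≤ μ.real (Set.Ici y) := measureReal_mono Set.Ioi_subset_Ici_self
    refine h1.trans_lt (lt_of_le_of_ne (measureReal_Ici_antitone μ (le_of_lt hy)) fun h => ?_)
    have h2 := hmax y
    rw [h] at h2
    have : p < y := hy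
    nlinarith
  have hIci : S ⊆ Set.Ici p := by
    intro y hy
    by_contra h
    rw [hSiff] at hy
    have : μ.real (Set.Ici p) ≤ μ.real (Set.Ioi y) :=
      measureReal_mono (Set.Ici_subset_Ioi.2 (not_le.1 h))
    linarith
  -- By `hSiff`, `p` belongs to `S` exactly when `μ` has an atom there; neither the mass nor the
  -- infimum of `S` depends on the case.
  refine ⟨p, hp, ?_, ?_, fun hne => ?_⟩
  · by_cases h : p ∈ S
    · rw [show S = Set.Ici p from Set.Subset.antisymm hIci ?_]
      · exact measurableSet_Ici
      · intro y hy
        rcases eq_or_lt_of_le (show p ≤ y from hy) with h' | h'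
        exacts [h' ▸ h, hIoi h']
    · rw [show S = Set.Ioi p from Set.Subset.antisymm ?_ hIoi]
      · exact measurableSet_Ioi
      · intro y hy
        have hpy : p ≤ y := hIci hy
        refine lt_of_le_of_ne hpy fun h' => h ?_
        rwa [h']
  · refine le_antisymm (measureReal_mono hIci) ?_
    by_cases h : p ∈ S
    · refine measureReal_mono fun y hy => ?_
      rcases eq_or_lt_of_le (show p ≤ y from hy) with h' | h'
      exacts [h' ▸ h, hIoi h']
    · rw [hSiff, not_lt] at h
      exact h.trans (measureReal_mono hIoi)
  · refine le_antisymm ?_ (le_csInf hne hIci)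
    refine le_of_forall_pos_le_add fun ε hε => csInf_le ⟨p, hIci⟩ (hIoi ?_)
    exact lt_add_of_pos_right p hε

end Ironing

/-! ### Reduction to one bidder against a random threshold -/

instance : IsProbabilityMeasure uniform01 := ⟨by simp [uniform01]⟩

theorem ae_uniform01_mem_Ioo : ∀ᵐ v ∂uniform01, v ∈ Set.Ioo (0 : ℝ) 1 := by
  unfold uniform01
  rw [← restrict_Ioo_eq_restrict_Icc]
  exact ae_restrict_mem measurableSet_Ioo

theorem integral_uniform01 (f : ℝ → ℝ) : ∫ v, f v ∂uniform01 = ∫ v in (0 : ℝ)..1, f v := by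
  unfold uniform01
  rw [integral_Icc_eq_integral_Ioc, intervalIntegral.integral_of_le zero_le_one]

theorem ae_prod_uniform01_mem_Ioo :
    ∀ᵐ z ∂uniform01.prod uniform01, z.1 ∈ Set.Ioo (0 : ℝ) 1 ∧ z.2 ∈ Set.Ioo (0 : ℝ) 1 :=
  (Measure.quasiMeasurePreserving_fst.ae ae_uniform01_mem_Ioo).and
    (Measure.quasiMeasurePreserving_snd.ae ae_uniform01_mem_Ioo)

open Classical in
/-- The ex-post utility of a bidder with value `v`, bid `b` and bid distribution `μ` who must
exceed the virtual value `τ`. -/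
noncomputable def payoff (μ : Measure ℝ) (τ : EReal) (b v : ℝ) : ℝ :=
  if τ < virtualValue μ b then v - sInf {x : ℝ | τ < virtualValue μ x} else 0

theorem wins_iff {i j : Fin 2} (hij : i ≠ j) (μ : Fin 2 → Measure ℝ) (b : Fin 2 → ℝ) :
    Wins μ b i ↔ max 0 (virtualValue (μ j) (b j)) < virtualValue (μ i) (b i) := by
  rw [max_lt_iff, Wins]
  refine and_congr_right fun _ => ⟨fun h => h j hij.symm, fun h k hk => ?_⟩
  have : k = j := by omega
  exact this ▸ h

theorem integral_pi_eq_prod {i j : Fin 2} (hij : i ≠ j) (f : ℝ × ℝ → ℝ) :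
    ∫ v : Fin 2 → ℝ, f (v i, v j) ∂(Measure.pi fun _ => uniform01) =
      ∫ z, f z ∂uniform01.prod uniform01 := by
  have h01 := (measurePreserving_piFinTwo fun _ : Fin 2 => uniform01).integral_comp'
    (g := fun z : ℝ × ℝ => f z)
  have hcases : (i = 0 ∧ j = 1) ∨ (i = 1 ∧ j = 0) := by omega
  rcases hcases with ⟨rfl, rfl⟩ | ⟨rfl, rfl⟩
  · exact h01
  · rw [← integral_prod_swap]
    exact (measurePreserving_piFinTwo fun _ : Fin 2 => uniform01).integral_comp'
      (g := fun z : ℝ × ℝ => f z.swap)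

/-- The payment minimises over the bidder's own bid with both reported laws fixed, so the rival
enters only through the threshold. -/
theorem utility_eq {i j : Fin 2} (hij : i ≠ j) (B : Fin 2 → ℝ → ℝ) :
    utility B i = ∫ z, payoff (bidLaw (B i)) (max 0 (virtualValue (bidLaw (B j)) (B j z.2)))
      (B i z.1) z.1 ∂uniform01.prod uniform01 := by
  rw [← integral_pi_eq_prod hij, utility]
  congr 1 with v
  have hset : {x : ℝ | Wins (fun k => bidLaw (B k))
      (Function.update (fun k => B k (v k)) i x) i} = {x : ℝ |
        max 0 (virtualValue (bidLaw (B j)) (B j (v j))) < virtualValue (bidLaw (B i)) x} := by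
    ext x
    simp [wins_iff hij, Function.update_of_ne hij.symm]
  simp only [allocation, payment, payoff]
  rw [hset]
  simp only [wins_iff hij]
  split_ifs <;> simp

/-! ### Affine strategies -/

section Affine

variable {s l : ℝ} {B : ℝ → ℝ}

theorem bidLaw_affine_Iic (hs : 0 < s) (hB : ∀ v, B v = s * v + l) (x : ℝ) :
    (bidLaw B).real (Set.Iic x) = max 0 (min ((x - l) / s) 1) := by
  have hBf : B = fun v => s * v + l := funext hB
  have hm : Measurable B := by rw [hBf]; fun_prop
  have hpre : B ⁻¹' Set.Iic x = Set.Iic ((x - l) / s) := by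
    ext v
    simp only [Set.mem_preimage, Set.mem_Iic, hB, le_div_iff₀ hs]
    constructor <;> intro h <;> linarith
  rw [bidLaw, map_measureReal_apply hm measurableSet_Iic, hpre, uniform01, Measure.real,
    Measure.restrict_apply measurableSet_Iic, Set.inter_comm, ← Set.Ici_inter_Iic, Set.inter_assoc,
    Set.Iic_inter_Iic, Set.Ici_inter_Iic, Real.volume_Icc, sub_zero, ENNReal.toReal_ofReal',
    min_comm, max_comm]

theorem isProbabilityMeasure_bidLaw (hB : AEMeasurable B uniform01) :
    IsProbabilityMeasure (bidLaw B) :=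
  Measure.isProbabilityMeasure_map hB

theorem isProbabilityMeasure_bidLaw_affine (hB : ∀ v, B v = s * v + l) :
    IsProbabilityMeasure (bidLaw B) := by
  refine isProbabilityMeasure_bidLaw ?_
  rw [funext hB]
  fun_prop

theorem virtualValue_affine_of_le (hs : 0 < s) (hB : ∀ v, B v = s * v + l) {x : ℝ} (hx : x ≤ l) :
    virtualValue (bidLaw B) x = ⊥ := by
  have := isProbabilityMeasure_bidLaw_affine hB
  have h : (bidLaw B).real (Set.Ioi x) = 1 := by
    rw [← Set.compl_Iic, probReal_compl_eq_one_sub measurableSet_Iic, bidLaw_affine_Iic hs hB,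
      max_eq_left, sub_zero]
    exact min_le_of_left_le (div_nonpos_of_nonpos_of_nonneg (by linarith) hs.le)
  simp [virtualValue, h]

theorem virtualValue_affine (hs : 0 < s) (hB : ∀ v, B v = s * v + l) {x : ℝ}
    (hx : x ∈ Set.Ioo l (l + s)) :
    virtualValue (bidLaw B) x = ((2 * x - (l + s) : ℝ) : EReal) := by
  have := isProbabilityMeasure_bidLaw_affine hB
  have hF : ∀ x, ProbabilityTheory.cdf (bidLaw B) x = max 0 (min ((x - l) / s) 1) := fun x => by
    rw [ProbabilityTheory.cdf_eq_real, bidLaw_affine_Iic hs hB]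
  have hin : ∀ x ∈ Set.Ioo l (l + s), max 0 (min ((x - l) / s) 1) = (x - l) / s := by
    intro x hx
    rw [min_eq_left, max_eq_right]
    · exact div_nonneg (by linarith [hx.1]) hs.le
    · rw [div_le_one hs]; linarith [hx.2]
  have hval : ∀ x ∈ Set.Ioo l (l + s), x - (1 - ProbabilityTheory.cdf (bidLaw B) x) / (1 / s) =
      2 * x - (l + s) := by
    intro x hx
    rw [hF, hin x hx]
    field_simp
    ring
  rw [← hval x hx]
  refine virtualValue_eq_of_regular (bidLaw B) (fun _ => 1 / s) l (l + s) ?_ ?_ ?_ ?_ ?_ x hx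
  · simp only [hF]; fun_prop
  · simp [hF]
  · rw [hF]; simp [hs.ne']
  · intro b hb
    refine ⟨?_, by positivity⟩
    have h1 : HasDerivAt (fun x => (x - l) / s) (1 / s) b :=
      ((hasDerivAt_id b).sub_const l).div_const s
    refine h1.congr_of_eventuallyEq ?_
    filter_upwards [Ioo_mem_nhds hb.1 hb.2] with y hy
    rw [hF, hin y hy]
  · refine MonotoneOn.congr (f₁ := fun b => 2 * b - (l + s)) (fun a _ b _ h => by simpa using h)
      fun b hb => (hval b hb).symm

theorem virtualValue_affine_bid (hs : 0 < s) (hB : ∀ v, B v = s * v + l) {v : ℝ}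
    (hv : v ∈ Set.Ioo (0 : ℝ) 1) :
    virtualValue (bidLaw B) (B v) = ((s * (2 * v - 1) + l : ℝ) : EReal) := by
  rw [virtualValue_affine hs hB, hB]
  · congr 1; ring
  · rw [hB]
    constructor <;> nlinarith [hv.1, hv.2]

/-- The bound `l - s ≤ T` places `(T + l + s) / 2`, the bid with virtual value `T`, at or above the
bottom `l` of the support; it is the payment. -/
theorem payoff_affine (hs : 0 < s) (hB : ∀ v, B v = s * v + l) {v T : ℝ}
    (hv : v ∈ Set.Ioo (0 : ℝ) 1) (hT : l - s ≤ T) :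
    payoff (bidLaw B) T (B v) v =
      if T < s * (2 * v - 1) + l then v - (T + l + s) / 2 else 0 := by
  have hwin : (T : EReal) < virtualValue (bidLaw B) (B v) ↔ T < s * (2 * v - 1) + l := by
    rw [virtualValue_affine_bid hs hB hv, EReal.coe_lt_coe_iff]
  rw [payoff]
  refine if_ctx_congr hwin (fun h => ?_) fun _ => rfl
  have hTs : T < l + s := by nlinarith [hv.2]
  congr 1
  have hsub : ∀ x ∈ {x : ℝ | (T : EReal) < virtualValue (bidLaw B) x}, (T + l + s) / 2 ≤ x := by
    intro x hx
    rw [Set.mem_ofPred_eq] at hx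
    rcases le_or_gt x l with hxl | hxl
    · rw [virtualValue_affine_of_le hs hB hxl] at hx
      exact absurd hx not_lt_bot
    -- Virtual values at or above the top of the support are not needed: a win forces `T < l + s`,
    -- so such bids exceed the claimed payment anyway.
    rcases le_or_gt (l + s) x with hxs | hxs
    · linarith
    · rw [virtualValue_affine hs hB ⟨hxl, hxs⟩, EReal.coe_lt_coe_iff] at hx
      linarith
  have hmem : ∀ x, (T + l + s) / 2 < x → x < l + s →
      x ∈ {x : ℝ | (T : EReal) < virtualValue (bidLaw B) x} := by
    intro x hx hxs
    rw [Set.mem_ofPred_eq, virtualValue_affine hs hB ⟨by linarith, hxs⟩, EReal.coe_lt_coe_iff]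
    linarith
  refine IsGLB.csInf_eq ⟨hsub, fun y hy => ?_⟩
    ⟨((T + l + s) / 2 + (l + s)) / 2, hmem _ (by linarith) (by linarith)⟩
  refine le_of_forall_gt_imp_ge_of_dense fun x hx => ?_
  rcases lt_or_ge x (l + s) with h' | h'
  · exact hy (hmem x hx h')
  · exact (hy (hmem (((T + l + s) / 2 + (l + s)) / 2) (by linarith) (by linarith))).trans
      (by linarith)

end Affine

/-! ### Two integral estimates on the unit interval -/

theorem integrable_uniform01_iff {f : ℝ → ℝ} :
    Integrable f uniform01 ↔ IntervalIntegrable f volume 0 1 := by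
  rw [intervalIntegrable_iff_integrableOn_Icc_of_le zero_le_one, IntegrableOn, uniform01]

/-- If `h` is antitone and nonnegative and `h (λ w) ≥ h w + (1 - λ) k w`, then `∫ k ≤ ∫ h`. -/
theorem integral_le_of_scaling {h k : ℝ → ℝ} (hh : Antitone h) (h0 : ∀ w, 0 ≤ h w)
    (hk : IntervalIntegrable k volume 0 1)
    (hscale : ∀ r ∈ Set.Ioo (0 : ℝ) 1, ∀ w ∈ Set.Ioo (0 : ℝ) 1, h w + (1 - r) * k w ≤ h (r * w)) :
    ∫ w in (0 : ℝ)..1, k w ≤ ∫ w in (0 : ℝ)..1, h w := by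
  set I := ∫ w in (0 : ℝ)..1, h w with hI
  set J := ∫ w in (0 : ℝ)..1, k w with hJ
  -- Integration by parts by dilation: integrating `hscale` and substituting gives `I + (1 - r) * J
  -- ≤ r⁻¹ * ∫ h` over `[0, r]`, hence at most `r⁻¹ * I`. Dividing out `1 - r` leaves `r * J ≤ I`,
  -- and `r → 1`.
  have key : ∀ r ∈ Set.Ioo (0 : ℝ) 1, r * J ≤ I := by
    intro r hr
    have hanti : Antitone fun w => h (r * w) := fun a b hab =>
      hh (mul_le_mul_of_nonneg_left hab hr.1.le)
    have h1 : ∫ w in (0 : ℝ)..1, (h w + (1 - r) * k w) ≤ ∫ w in (0 : ℝ)..1, h (r * w) :=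
      intervalIntegral.integral_mono_on_of_le_Ioo zero_le_one
        (hh.intervalIntegrable.add (hk.const_mul _)) hanti.intervalIntegrable (hscale r hr)
    rw [intervalIntegral.integral_add hh.intervalIntegrable (hk.const_mul _),
      intervalIntegral.integral_const_mul, intervalIntegral.integral_comp_mul_left _ hr.1.ne',
      mul_zero, mul_one, smul_eq_mul, ← hI, ← hJ] at h1
    have h2 : ∫ w in (0 : ℝ)..r, h w ≤ I := by
      rw [hI, ← intervalIntegral.integral_add_adjacent_intervals
        (hh.intervalIntegrable (a := 0) (b := r)) (hh.intervalIntegrable (a := r) (b := 1))]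
      linarith [intervalIntegral.integral_nonneg (f := h) (μ := volume) hr.2.le fun w _ => h0 w]
    have h3 : I + (1 - r) * J ≤ r⁻¹ * I :=
      h1.trans (mul_le_mul_of_nonneg_left h2 (inv_nonneg.2 hr.1.le))
    have h4 : r * (I + (1 - r) * J) ≤ I := by
      have := mul_le_mul_of_nonneg_left h3 hr.1.le
      rwa [mul_inv_cancel_left₀ hr.1.ne'] at this
    nlinarith [hr.2]
  have hlim : Filter.Tendsto (fun r : ℝ => r * J) (nhdsWithin 1 (Set.Iio 1)) (nhds (1 * J)) :=
    ((continuous_id.mul continuous_const).tendsto 1).mono_left nhdsWithin_le_nhds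
  rw [one_mul] at hlim
  refine le_of_tendsto hlim ?_
  filter_upwards [Ioo_mem_nhdsLT (zero_lt_one (α := ℝ))] with r hr using key r hr

theorem integral_max_sub {w : ℝ} (hw : w ∈ Set.Icc (0 : ℝ) 1) :
    ∫ v in (0 : ℝ)..1, max (v - w) 0 = (1 - w) ^ 2 / 2 := by
  have hc : Continuous fun v : ℝ => max (v - w) 0 := by fun_prop
  rw [← intervalIntegral.integral_add_adjacent_intervals (b := w) (hc.intervalIntegrable _ _)
    (hc.intervalIntegrable _ _)]
  have h1 : ∫ v in (0 : ℝ)..w, max (v - w) 0 = 0 := by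
    rw [intervalIntegral.integral_congr (g := fun _ => (0 : ℝ)), intervalIntegral.integral_zero]
    intro v hv
    rw [Set.uIcc_of_le hw.1] at hv
    exact max_eq_right (by linarith [hv.2])
  have h2 : ∫ v in w..1, max (v - w) 0 = ∫ v in w..1, (v - w) := by
    refine intervalIntegral.integral_congr fun v hv => ?_
    rw [Set.uIcc_of_le hw.2] at hv
    exact max_eq_left (by linarith [hv.1])
  rw [h1, h2, intervalIntegral.integral_sub (by simp) (by simp), integral_id]
  simp
  ring

/-! ### Utility bounds for monotone strategies -/

section Monotone

variable {B : ℝ → ℝ}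

theorem aemeasurable_of_monotoneOn (hB : MonotoneOn B (Set.Icc 0 1)) :
    AEMeasurable B uniform01 :=
  aemeasurable_restrict_of_monotoneOn measurableSet_Icc hB

theorem bidLaw_real_apply (hB : AEMeasurable B uniform01) {s : Set ℝ} (hs : MeasurableSet s) :
    (bidLaw B).real s = uniform01.real (B ⁻¹' s) := by
  rw [bidLaw, Measure.real, Measure.real, Measure.map_apply_of_aemeasurable hB hs]

theorem bidLaw_Ici_of_monotoneOn (hB : MonotoneOn B (Set.Icc 0 1)) :
    (bidLaw B).real (Set.Ici (B 0)) = 1 := by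
  have hae : B ⁻¹' Set.Ici (B 0) =ᵐ[uniform01] Set.univ := by
    rw [Filter.eventuallyEq_univ]
    filter_upwards [ae_uniform01_mem_Ioo] with v hv
    exact hB ⟨le_rfl, zero_le_one⟩ ⟨hv.1.le, hv.2.le⟩ hv.1.le
  rw [bidLaw_real_apply (aemeasurable_of_monotoneOn hB) measurableSet_Ici, measureReal_congr hae]
  simp

theorem bidLaw_Ici_eq_zero_of_monotoneOn (hB : MonotoneOn B (Set.Icc 0 1)) (x : ℝ)
    (hx : B 1 < x) : (bidLaw B).real (Set.Ici x) = 0 := by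
  have hae : B ⁻¹' Set.Ici x =ᵐ[uniform01] (∅ : Set ℝ) := by
    rw [Filter.eventuallyEq_empty]
    filter_upwards [ae_uniform01_mem_Ioo] with v hv hmem
    have h1 : B v ≤ B 1 := hB ⟨hv.1.le, hv.2.le⟩ ⟨zero_le_one, le_rfl⟩ hv.2.le
    have h2 : x ≤ B v := hmem
    linarith
  rw [bidLaw_real_apply (aemeasurable_of_monotoneOn hB) measurableSet_Ici, measureReal_congr hae]
  simp

/-- The expected utility against a fixed virtual value `m`, in terms of the largest profit. -/
theorem integral_payoff_le (hB : MonotoneOn B (Set.Icc 0 1)) {w : ℝ}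
    (hw : w ∈ Set.Icc (0 : ℝ) 1) (m : ℝ) :
    ∫ v, payoff (bidLaw B) (m : EReal) (B v) v ∂uniform01 ≤ (1 - w) ^ 2 / 2 +
      ((w - m) * (bidLaw B).real {x | (m : EReal) < virtualValue (bidLaw B) x} -
        maxProfit (bidLaw B) m) := by
  have hBm := aemeasurable_of_monotoneOn hB
  have := isProbabilityMeasure_bidLaw hBm
  obtain ⟨p, hp, hSm, hS, hinf⟩ := exists_threshold (bidLaw_Ici_of_monotoneOn hB)
    (bidLaw_Ici_eq_zero_of_monotoneOn hB) m
  set S := {x | (m : EReal) < virtualValue (bidLaw B) x} with hSdef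
  have hA : NullMeasurableSet (B ⁻¹' S) uniform01 := hBm.nullMeasurable hSm
  have hpay : (fun v => payoff (bidLaw B) (m : EReal) (B v) v) =
      (B ⁻¹' S).indicator fun v => v - p := by
    ext v
    by_cases hv : v ∈ B ⁻¹' S
    · rw [Set.indicator_of_mem hv, payoff,
        if_pos (show (m : EReal) < virtualValue (bidLaw B) (B v) from hv), hinf ⟨_, hv⟩]
    · rw [Set.indicator_of_notMem hv, payoff,
        if_neg (show ¬(m : EReal) < virtualValue (bidLaw B) (B v) from hv)]
  have hint : Integrable (fun v : ℝ => v - p) uniform01 :=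
    integrable_uniform01_iff.2 ((by fun_prop : Continuous fun v : ℝ => v - p).intervalIntegrable _ _)
  have hint2 : Integrable (fun v : ℝ => max (v - w) 0) uniform01 :=
    integrable_uniform01_iff.2
      ((by fun_prop : Continuous fun v : ℝ => max (v - w) 0).intervalIntegrable _ _)
  have hint3 : Integrable ((B ⁻¹' S).indicator fun _ => w - p) uniform01 :=
    (integrable_const _).indicator₀ hA
  -- On the winning set `v - p = (v - w) + (w - p)`, and replacing `v - w` by its positive part
  -- everywhere can only help.
  have hle : ∫ v, payoff (bidLaw B) (m : EReal) (B v) v ∂uniform01 ≤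
      ∫ v, (max (v - w) 0 + (B ⁻¹' S).indicator (fun _ => w - p) v) ∂uniform01 := by
    rw [hpay]
    refine integral_mono (hint.indicator₀ hA) (hint2.add hint3) fun v => ?_
    by_cases hv : v ∈ B ⁻¹' S
    · simp only [Set.indicator_of_mem hv]
      linarith [le_max_left (v - w) 0]
    · simp only [Set.indicator_of_notMem hv, add_zero]
      exact le_max_right _ _
  refine hle.trans_eq ?_
  rw [integral_add hint2 hint3, integral_uniform01 (fun v => max (v - w) 0), integral_max_sub hw,
    integral_indicator₀ hA, setIntegral_const, ← bidLaw_real_apply hBm hSm, smul_eq_mul, ← hp, hS]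
  ring

/-- The convexity of the largest profit in the cost. -/
theorem maxProfit_add_le (hB : MonotoneOn B (Set.Icc 0 1)) (m m' : ℝ) :
    maxProfit (bidLaw B) m +
      (m - m') * (bidLaw B).real {x | (m : EReal) < virtualValue (bidLaw B) x} ≤
      maxProfit (bidLaw B) m' := by
  have := isProbabilityMeasure_bidLaw (aemeasurable_of_monotoneOn hB)
  obtain ⟨p, hp, -, hS, -⟩ := exists_threshold (bidLaw_Ici_of_monotoneOn hB)
    (bidLaw_Ici_eq_zero_of_monotoneOn hB) m
  rw [hS, ← hp]
  linarith [le_maxProfit (bidLaw_Ici_eq_zero_of_monotoneOn hB) m' p]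

end Monotone

/-! ### The equilibrium in monotone strategies -/

theorem max_virtualValue_quarter {B : ℝ → ℝ} (hB : ∀ v, B v = 1 / 4 * v + 1 / 4) {w : ℝ}
    (hw : w ∈ Set.Ioo (0 : ℝ) 1) :
    max 0 (virtualValue (bidLaw B) (B w)) = ((w / 2 : ℝ) : EReal) := by
  rw [virtualValue_affine_bid (by norm_num) hB hw, max_eq_right]
  · congr 1; ring
  · rw [EReal.coe_nonneg]; linarith [hw.1]

/-- Against the strategy `(v + 1) / 4` no monotone strategy has a utility above `1 / 6`. -/
theorem utility_le_of_monotoneOn {i j : Fin 2} (hij : i ≠ j) {B : Fin 2 → ℝ → ℝ}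
    (hBj : ∀ v, B j v = 1 / 4 * v + 1 / 4) (hBi : MonotoneOn (B i) (Set.Icc 0 1)) :
    utility B i ≤ 1 / 6 := by
  have := isProbabilityMeasure_bidLaw (aemeasurable_of_monotoneOn hBi)
  have hu := bidLaw_Ici_eq_zero_of_monotoneOn hBi
  rw [utility_eq hij]
  set f : ℝ × ℝ → ℝ := fun z => payoff (bidLaw (B i))
    (max 0 (virtualValue (bidLaw (B j)) (B j z.2))) (B i z.1) z.1 with hf
  -- Fubini needs integrability; otherwise the Bochner integral is zero by convention and the bound
  -- is trivial.
  by_cases hint : Integrable f (uniform01.prod uniform01)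
  swap
  · rw [integral_undef hint]; norm_num
  rw [integral_prod_symm f hint]
  set h : ℝ → ℝ := fun w => maxProfit (bidLaw (B i)) (w / 2) with hh
  set k : ℝ → ℝ := fun w =>
    (bidLaw (B i)).real {x | ((w / 2 : ℝ) : EReal) < virtualValue (bidLaw (B i)) x} with hk
  have hanti : Antitone h := fun a b hab => maxProfit_antitone hu (by linarith)
  have kanti : Antitone k := fun a b hab => measureReal_mono fun x hx =>
    lt_of_le_of_lt (EReal.coe_le_coe_iff.2 (by linarith)) hx
  have kint : IntervalIntegrable (fun w => w / 2 * k w) volume 0 1 :=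
    kanti.intervalIntegrable.continuousOn_mul (by fun_prop)
  have cint : IntervalIntegrable (fun w : ℝ => (1 - w) ^ 2 / 2) volume 0 1 :=
    (by fun_prop : Continuous fun w : ℝ => (1 - w) ^ 2 / 2).intervalIntegrable _ _
  have hscale : ∫ w in (0 : ℝ)..1, w / 2 * k w ≤ ∫ w in (0 : ℝ)..1, h w := by
    refine integral_le_of_scaling hanti (fun w => maxProfit_nonneg hu _) kint fun r _ w _ => ?_
    have := maxProfit_add_le hBi (w / 2) (r * w / 2)
    simp only [hh, hk]
    linarith
  calc ∫ w, ∫ v, f (v, w) ∂uniform01 ∂uniform01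
      ≤ ∫ w, ((1 - w) ^ 2 / 2 + (w / 2 * k w - h w)) ∂uniform01 := by
        refine integral_mono_ae hint.integral_prod_right (integrable_uniform01_iff.2
          (cint.add (kint.sub hanti.intervalIntegrable))) ?_
        filter_upwards [ae_uniform01_mem_Ioo] with w hw
        simp only [hf, max_virtualValue_quarter hBj hw]
        -- At cost `w / 2` the margin `w - w / 2` is again `w / 2`, precisely the coefficient of `k`
        -- in the scaling inequality for `h`.
        refine (integral_payoff_le hBi ⟨hw.1.le, hw.2.le⟩ (w / 2)).trans_eq ?_
        rw [sub_half]
    _ = 1 / 6 + ((∫ w in (0 : ℝ)..1, w / 2 * k w) - ∫ w in (0 : ℝ)..1, h w) := by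
        rw [integral_uniform01, intervalIntegral.integral_add cint
          (kint.sub hanti.intervalIntegrable),
          intervalIntegral.integral_sub kint hanti.intervalIntegrable]
        congr 1
        rw [intervalIntegral.integral_div,
          intervalIntegral.integral_comp_sub_left (fun w : ℝ => w ^ 2) 1]
        norm_num
    _ ≤ 1 / 6 := by linarith

/-- The expected utility from the bids `s * v + l` against the virtual value `T`. -/
noncomputable def interimUtility (s l T : ℝ) : ℝ :=
  (1 - min 1 ((T - l + s) / (2 * s)) ^ 2) / 2 -
    (1 - min 1 ((T - l + s) / (2 * s))) * ((T + l + s) / 2)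

theorem integral_ite_affine {s l T : ℝ} (hs : 0 < s) (hT : l - s ≤ T) :
    ∫ v in (0 : ℝ)..1, (if T < s * (2 * v - 1) + l then v - (T + l + s) / 2 else 0) =
      interimUtility s l T := by
  unfold interimUtility
  set c := (T - l + s) / (2 * s) with hc
  set d := min 1 c with hd
  have hc0 : 0 ≤ c := div_nonneg (by linarith) (by linarith)
  have hd0 : 0 ≤ d := le_min zero_le_one hc0
  have hd1 : d ≤ 1 := min_le_left _ _
  have hiff : ∀ v : ℝ, T < s * (2 * v - 1) + l ↔ c < v := fun v => by
    rw [hc, div_lt_iff₀ (by linarith)]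
    constructor <;> intro h <;> linarith
  have hleft : Set.EqOn (fun v : ℝ => if T < s * (2 * v - 1) + l then v - (T + l + s) / 2 else 0)
      (fun _ => 0) (Set.Ioo 0 d) := fun v hv =>
    if_neg (by rw [hiff]; exact not_lt.2 (hv.2.le.trans (min_le_right _ _)))
  have hright : Set.EqOn (fun v : ℝ => if T < s * (2 * v - 1) + l then v - (T + l + s) / 2 else 0)
      (fun v => v - (T + l + s) / 2) (Set.Ioo d 1) := fun v hv =>
    if_pos (by rw [hiff]; exact (min_lt_iff.1 hv.1).resolve_left (not_lt.2 hv.2.le))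
  have hcont : Continuous fun v : ℝ => v - (T + l + s) / 2 := by fun_prop
  have i1 : IntervalIntegrable (fun v : ℝ => if T < s * (2 * v - 1) + l then
      v - (T + l + s) / 2 else 0) volume 0 d :=
    (intervalIntegrable_const (c := (0 : ℝ))).congr_uIoo (by
      rw [Set.uIoo_of_le hd0]; exact hleft.symm)
  have i2 : IntervalIntegrable (fun v : ℝ => if T < s * (2 * v - 1) + l then
      v - (T + l + s) / 2 else 0) volume d 1 :=
    (hcont.intervalIntegrable d 1).congr_uIoo (by
      rw [Set.uIoo_of_le hd1]; exact hright.symm)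
  rw [← intervalIntegral.integral_add_adjacent_intervals i1 i2,
    intervalIntegral.integral_congr_Ioo_of_le hd0 hleft,
    intervalIntegral.integral_congr_Ioo_of_le hd1 hright, intervalIntegral.integral_zero,
    intervalIntegral.integral_sub (by simp) (by simp), integral_id,
    intervalIntegral.integral_const, smul_eq_mul]
  ring

theorem utility_affine {i j : Fin 2} (hij : i ≠ j) {B : Fin 2 → ℝ → ℝ} {s l : ℝ} (hs : 0 < s)
    (hB : ∀ v, B i v = s * v + l) {T : ℝ → ℝ} (hTm : Measurable T) (hTl : ∀ w, l - s ≤ T w)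
    (hT : ∀ w ∈ Set.Ioo (0 : ℝ) 1,
      max 0 (virtualValue (bidLaw (B j)) (B j w)) = (T w : EReal)) :
    utility B i = ∫ w in (0 : ℝ)..1, interimUtility s l (T w) := by
  set F : ℝ × ℝ → ℝ := fun z =>
    if T z.2 < s * (2 * z.1 - 1) + l then z.1 - (T z.2 + l + s) / 2 else 0 with hF
  have hFm : Measurable F := by
    have hTm2 : Measurable fun z : ℝ × ℝ => T z.2 := hTm.comp measurable_snd
    refine Measurable.ite (measurableSet_lt hTm2 (by fun_prop)) ?_ measurable_const
    exact measurable_fst.sub (((hTm2.add_const l).add_const s).div_const 2)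
  have hFint : Integrable F (uniform01.prod uniform01) := by
    refine Integrable.of_bound hFm.aestronglyMeasurable (1 + |l| + s) ?_
    filter_upwards [ae_prod_uniform01_mem_Ioo] with z hz
    have h1 := hTl z.2
    have h2 := neg_abs_le l
    have h3 := le_abs_self l
    simp only [hF, Real.norm_eq_abs, abs_le]
    split_ifs with h
    · constructor <;> nlinarith [hz.1.1, hz.1.2]
    · constructor <;> linarith
  have hae : ∫ z, payoff (bidLaw (B i)) (max 0 (virtualValue (bidLaw (B j)) (B j z.2)))
      (B i z.1) z.1 ∂uniform01.prod uniform01 = ∫ z, F z ∂uniform01.prod uniform01 := by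
    refine integral_congr_ae ?_
    filter_upwards [ae_prod_uniform01_mem_Ioo] with z hz
    rw [hT z.2 hz.2, payoff_affine hs hB hz.1 (hTl z.2)]
  rw [utility_eq hij, hae, integral_prod_symm F hFint, integral_uniform01]
  refine intervalIntegral.integral_congr fun w _ => ?_
  simp only [hF, integral_uniform01]
  exact integral_ite_affine hs (hTl w)

theorem utility_quarter {i j : Fin 2} (hij : i ≠ j) {B : Fin 2 → ℝ → ℝ}
    (hB : ∀ i v, B i v = 1 / 4 * v + 1 / 4) : utility B i = 1 / 6 := by
  -- The maximum with zero only serves `w` outside the unit interval, since the lower bound on the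
  -- threshold is required everywhere.
  rw [utility_affine hij (by norm_num) (hB i) (T := fun w => max 0 (w / 2)) (by fun_prop)
    (fun w => by simp) fun w hw => ?_]
  · have : Set.EqOn (fun w : ℝ => interimUtility (1 / 4) (1 / 4) (max 0 (w / 2)))
        (fun w => (1 - w ^ 2) / 4) (Set.Ioo 0 1) := fun w hw => by
      simp only [interimUtility]
      rw [max_eq_right (by linarith [hw.1]),
        show (w / 2 - 1 / 4 + 1 / 4) / (2 * (1 / 4)) = w by ring, min_eq_right hw.2.le]
      ring
    rw [intervalIntegral.integral_congr_Ioo_of_le zero_le_one this,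
      intervalIntegral.integral_div, intervalIntegral.integral_sub (by simp) (by simp)]
    norm_num
  · rw [max_virtualValue_quarter (hB j) hw, max_eq_right (by linarith [hw.1])]

theorem isNashEquilibrium_monotoneStrategies :
    IsNashEquilibrium monotoneStrategies (fun (_ : Fin 2) (v : ℝ) => (v + 1) / 4) := by
  refine ⟨fun i a _ b _ h => by simp only; linarith, fun i B' hB' => ?_⟩
  obtain ⟨j, hij⟩ : ∃ j, i ≠ j := ⟨i + 1, by omega⟩
  refine (utility_le_of_monotoneOn hij (fun v => ?_) ?_).trans_eq
    (utility_quarter hij fun _ v => by ring).symm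
  · rw [Function.update_of_ne hij.symm]; ring
  · rw [Function.update_self]; exact hB'

/-! ### Utilities under linear shading -/

/-- At cost zero no price earns anything from a point mass at zero, so the price `1`, which never
sells, is already optimal. -/
theorem virtualValue_zero_strategy {B : ℝ → ℝ} (hB : ∀ v, B v = 0) :
    virtualValue (bidLaw B) 0 ≤ 0 := by
  have hmono : MonotoneOn B (Set.Icc 0 1) := fun a _ b _ _ => by rw [hB, hB]
  have := isProbabilityMeasure_bidLaw (aemeasurable_of_monotoneOn hmono)
  have hu := bidLaw_Ici_eq_zero_of_monotoneOn hmono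
  rw [← EReal.coe_zero]
  have h1 : (bidLaw B).real (Set.Ici 1) = 0 := hu 1 (by rw [hB]; exact zero_lt_one)
  refine virtualValue_le_of_isMax (p := 1) (bidLaw_Ici_of_monotoneOn hmono) hu (fun x => ?_) ?_
  · rw [h1, mul_zero, sub_zero]
    rcases le_or_gt x 0 with h | h
    · exact mul_nonpos_of_nonpos_of_nonneg h measureReal_nonneg
    · rw [hu x (by rwa [hB]), mul_zero]
  · rw [h1]; exact measureReal_nonneg

theorem utility_zero_strategy {i j : Fin 2} (hij : i ≠ j) {B : Fin 2 → ℝ → ℝ}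
    (hB : ∀ v, B i v = 0) : utility B i = 0 := by
  rw [utility_eq hij, integral_eq_zero_of_ae]
  filter_upwards with z
  rw [payoff, hB z.1, if_neg, Pi.zero_apply]
  exact not_lt.2 ((virtualValue_zero_strategy hB).trans (le_max_left _ _))

theorem max_virtualValue_linear {B : ℝ → ℝ} {β : ℝ} (hβ : 0 ≤ β) (hB : ∀ v, B v = β * v) {w : ℝ}
    (hw : w ∈ Set.Ioo (0 : ℝ) 1) :
    max 0 (virtualValue (bidLaw B) (B w)) = ((max 0 (β * (2 * w - 1)) : ℝ) : EReal) := by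
  rcases hβ.eq_or_lt with rfl | hβ
  · have hB' : ∀ v, B v = 0 := fun v => by rw [hB, zero_mul]
    rw [hB', max_eq_left (virtualValue_zero_strategy hB')]
    simp
  · rw [virtualValue_affine_bid (l := 0) hβ (fun v => by rw [hB, add_zero]) hw, add_zero,
      EReal.coe_strictMono.monotone.map_max, EReal.coe_zero]

/-- The expected utility of the linear shading factor `α` against the factor `β`. -/
noncomputable def linearUtility (α β : ℝ) : ℝ :=
  if α = 0 then 0
  else if α ≤ β then 3 / 16 - α / 8 + 5 * α / (48 * β) - α ^ 2 / (12 * β)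
  else 3 / 8 - α / 4 - β ^ 2 / (48 * α ^ 2) - β / (16 * α) + β ^ 2 / (24 * α)

theorem integral_quadratic (a b A C D : ℝ) :
    ∫ w in a..b, (A + C * (2 * w - 1) + D * (2 * w - 1) ^ 2) =
      (A * b + C * (b ^ 2 - b) + D * (2 * b - 1) ^ 3 / 6) -
        (A * a + C * (a ^ 2 - a) + D * (2 * a - 1) ^ 3 / 6) := by
  refine intervalIntegral.integral_eq_sub_of_hasDerivAt
    (f := fun w => A * w + C * (w ^ 2 - w) + D * (2 * w - 1) ^ 3 / 6) (fun w _ => ?_)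
    ((by fun_prop : Continuous _).intervalIntegrable _ _)
  have h1 := (hasDerivAt_id w).const_mul A
  have h2 := (((hasDerivAt_id w).pow 2).sub (hasDerivAt_id w)).const_mul C
  have h3 := ((((((hasDerivAt_id w).const_mul 2).sub_const 1)).pow 3).const_mul D).div_const 6
  refine ((h1.add h2).add h3).congr_deriv ?_
  simp
  ring

/-- The integrand is piecewise quadratic, with breaks where the rival's virtual value turns positive
(`w = 1 / 2`) and, if `α ≤ β`, where it reaches the bidder's largest virtual value `α` (`w = (1 + α
/ β) / 2`), beyond which the bidder never wins. -/
theorem integral_interimUtility {α β : ℝ} (hα : 0 < α) (hβ : 0 ≤ β) :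
    ∫ w in (0 : ℝ)..1, interimUtility α 0 (max 0 (β * (2 * w - 1))) = linearUtility α β := by
  have hc : Continuous fun w : ℝ => interimUtility α 0 (max 0 (β * (2 * w - 1))) := by
    unfold interimUtility
    fun_prop
  rw [← intervalIntegral.integral_add_adjacent_intervals (b := 1 / 2)
    (hc.intervalIntegrable _ _) (hc.intervalIntegrable _ _)]
  have h1 : ∫ w in (0 : ℝ)..(1 / 2), interimUtility α 0 (max 0 (β * (2 * w - 1))) =
      3 / 16 - α / 8 := by
    rw [intervalIntegral.integral_congr (g := fun _ => 3 / 8 - α / 4)]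
    · rw [intervalIntegral.integral_const, smul_eq_mul]; ring
    · intro w hw
      rw [Set.uIcc_of_le (by norm_num)] at hw
      have hT : max 0 (β * (2 * w - 1)) = 0 := max_eq_left (by nlinarith [hw.2])
      simp only [hT, interimUtility]
      rw [show (0 - 0 + α) / (2 * α) = 1 / 2 by field_simp; ring, min_eq_right (by norm_num)]
      ring
  have hquad : ∀ w : ℝ, 1 / 2 ≤ w → β * (2 * w - 1) ≤ α →
      interimUtility α 0 (max 0 (β * (2 * w - 1))) =
        (3 / 8 - α / 4) + (-(β / α) / 4 - β / 4 + β / 4) * (2 * w - 1) +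
          (β ^ 2 / (4 * α) - β ^ 2 / (8 * α ^ 2)) * (2 * w - 1) ^ 2 := by
    intro w hw hle
    rw [max_eq_right (mul_nonneg hβ (by linarith)), interimUtility, min_eq_right]
    · field_simp
      ring
    · rw [div_le_one (by linarith)]; linarith
  rw [h1, linearUtility, if_neg hα.ne']
  split_ifs with hle
  · have hβ' : 0 < β := hα.trans_le hle
    have hab : α / β ≤ 1 := (div_le_one hβ').2 hle
    have hab0 : 0 < α / β := by positivity
    have hbab : β * (α / β) = α := mul_div_cancel₀ α hβ'.ne'
    rw [← intervalIntegral.integral_add_adjacent_intervals (b := (1 + α / β) / 2)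
      (hc.intervalIntegrable _ _) (hc.intervalIntegrable _ _)]
    have h3 : ∫ w in ((1 + α / β) / 2)..1, interimUtility α 0 (max 0 (β * (2 * w - 1))) = 0 := by
      rw [intervalIntegral.integral_congr (g := fun _ => (0 : ℝ)), intervalIntegral.integral_zero]
      intro w hw
      rw [Set.uIcc_of_le (by linarith)] at hw
      have hge : α ≤ max 0 (β * (2 * w - 1)) := by
        refine le_max_of_le_right ?_
        nlinarith [hw.1, mul_le_mul_of_nonneg_left hw.1 hβ]
      simp only [interimUtility]
      rw [min_eq_left]
      · ring
      · rw [le_div_iff₀ (by linarith)]; linarith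
    rw [h3, intervalIntegral.integral_congr fun w hw => hquad w ?_ ?_, integral_quadratic]
    · field_simp
      ring
    · rw [Set.uIcc_of_le (by linarith)] at hw
      exact hw.1
    · rw [Set.uIcc_of_le (by linarith)] at hw
      nlinarith [mul_le_mul_of_nonneg_left hw.2 hβ]
  · push Not at hle
    rw [intervalIntegral.integral_congr fun w hw => hquad w ?_ ?_, integral_quadratic]
    · field_simp
      ring
    · rw [Set.uIcc_of_le (by norm_num)] at hw
      exact hw.1
    · rw [Set.uIcc_of_le (by norm_num)] at hw
      nlinarith [mul_le_mul_of_nonneg_left hw.2 hβ]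

theorem utility_linear {i j : Fin 2} (hij : i ≠ j) {B : Fin 2 → ℝ → ℝ} {α β : ℝ} (hα : 0 ≤ α)
    (hβ : 0 ≤ β) (hi : ∀ v, B i v = α * v) (hj : ∀ v, B j v = β * v) :
    utility B i = linearUtility α β := by
  rcases hα.eq_or_lt with rfl | hα
  · rw [utility_zero_strategy hij fun v => by rw [hi, zero_mul], linearUtility, if_pos rfl]
  · rw [utility_affine hij (l := 0) hα (fun v => by rw [hi, add_zero])
      (T := fun w => max 0 (β * (2 * w - 1))) (by fun_prop)
      (fun w => le_max_of_le_left (by linarith)) fun w hw => max_virtualValue_linear hβ hj hw]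
    exact integral_interimUtility hα hβ

/-! ### Best responses among linear factors -/

section BestResponse

variable {α β : ℝ}

theorem hasDerivAt_lower (hβ : 0 < β) :
    HasDerivAt (fun a => 3 / 16 - a / 8 + 5 * a / (48 * β) - a ^ 2 / (12 * β))
      ((5 - 8 * α - 6 * β) / (48 * β)) α := by
  have h := ((((hasDerivAt_id α).div_const 8).const_sub (3 / 16)).add
    (((hasDerivAt_id α).const_mul 5).div_const (48 * β))).sub
      (((hasDerivAt_id α).pow 2).div_const (12 * β))
  refine h.congr_deriv ?_
  simp
  field_simp
  ring

theorem hasDerivAt_upper (hα : 0 < α) :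
    HasDerivAt
      (fun a => 3 / 8 - a / 4 - β ^ 2 / (48 * a ^ 2) - β / (16 * a) + β ^ 2 / (24 * a))
      ((2 * β ^ 2 + 3 * α * β - 2 * α * β ^ 2 - 12 * α ^ 3) / (48 * α ^ 3)) α := by
  have hid := hasDerivAt_id α
  have h := ((((hid.div_const 4).const_sub (3 / 8)).sub
    ((hasDerivAt_const α (β ^ 2)).div ((hid.pow 2).const_mul 48) (by simp [hα.ne']))).sub
    ((hasDerivAt_const α β).div (hid.const_mul 16) (by simp [hα.ne']))).add
    ((hasDerivAt_const α (β ^ 2)).div (hid.const_mul 24) (by simp [hα.ne']))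
  refine h.congr_deriv ?_
  simp
  field_simp
  ring

theorem linearUtility_of_le {a : ℝ} (ha : 0 < a) (h : a ≤ β) :
    linearUtility a β = 3 / 16 - a / 8 + 5 * a / (48 * β) - a ^ 2 / (12 * β) := by
  rw [linearUtility, if_neg ha.ne', if_pos h]

theorem linearUtility_of_ge {a : ℝ} (ha : 0 < a) (h : β ≤ a) :
    linearUtility a β =
      3 / 8 - a / 4 - β ^ 2 / (48 * a ^ 2) - β / (16 * a) + β ^ 2 / (24 * a) := by
  rcases h.eq_or_lt with rfl | h
  · rw [linearUtility_of_le ha le_rfl]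
    field_simp
    ring
  · rw [linearUtility, if_neg ha.ne', if_neg (not_le.2 h)]

/-- Against the factor zero the utility `3 / 8 - a / 4` increases as `a` decreases to zero, but
drops to zero at `a = 0`, so no best response exists. -/
theorem pos_of_bestResponse (hα : 0 ≤ α) (hβ : 0 ≤ β)
    (h : ∀ a, 0 ≤ a → linearUtility a β ≤ linearUtility α β) : 0 < β := by
  refine hβ.lt_of_ne fun h0 => ?_
  subst h0
  have hval : ∀ a : ℝ, 0 < a → linearUtility a 0 = 3 / 8 - a / 4 := fun a ha => by
    rw [linearUtility_of_ge ha ha.le]; simp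
  rcases hα.eq_or_lt with rfl | hα
  · have := h 1 zero_le_one
    rw [hval 1 one_pos, linearUtility, if_pos rfl] at this
    norm_num at this
  · have := h (α / 2) (by positivity)
    rw [hval _ hα, hval _ (by positivity)] at this
    linarith

theorem isLocalMax_of_bestResponse (hα : 0 < α)
    (h : ∀ a, 0 ≤ a → linearUtility a β ≤ linearUtility α β) :
    IsLocalMax (fun a => linearUtility a β) α := by
  filter_upwards [Ioi_mem_nhds hα] with a ha using h a (le_of_lt ha)

theorem eq_of_bestResponse_of_lt (hα : 0 < α) (hαβ : α < β)
    (h : ∀ a, 0 ≤ a → linearUtility a β ≤ linearUtility α β) : 8 * α + 6 * β = 5 := by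
  have hβ := hα.trans hαβ
  have hd : HasDerivAt (fun a => linearUtility a β) _ α :=
    (hasDerivAt_lower hβ).congr_of_eventuallyEq <| by
      filter_upwards [Ioo_mem_nhds hα hαβ] with a ha using linearUtility_of_le ha.1 ha.2.le
  have h0 := (isLocalMax_of_bestResponse hα h).hasDerivAt_eq_zero hd
  rw [div_eq_zero_iff] at h0
  rcases h0 with h0 | h0 <;> linarith

theorem eq_of_bestResponse_of_gt (hβ : 0 < β) (hαβ : β < α)
    (h : ∀ a, 0 ≤ a → linearUtility a β ≤ linearUtility α β) :
    12 * α ^ 3 + 2 * α * β ^ 2 = 2 * β ^ 2 + 3 * α * β := by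
  have hα := hβ.trans hαβ
  have hd : HasDerivAt (fun a => linearUtility a β) _ α :=
    (hasDerivAt_upper hα).congr_of_eventuallyEq <| by
      filter_upwards [Ioi_mem_nhds hαβ] with a ha
      exact linearUtility_of_ge (hβ.trans ha) (le_of_lt ha)
  have h0 := (isLocalMax_of_bestResponse hα h).hasDerivAt_eq_zero hd
  rw [div_eq_zero_iff] at h0
  rcases h0 with h0 | h0
  · linarith
  · exact absurd h0 (by positivity)

/-- The two branches have the same derivative on the diagonal, so the utility is differentiable
there despite the case split. -/
theorem eq_of_bestResponse_self (hα : 0 < α)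
    (h : ∀ a, 0 ≤ a → linearUtility a α ≤ linearUtility α α) : α = 5 / 14 := by
  have hlow : HasDerivWithinAt (fun a => linearUtility a α)
      ((5 - 8 * α - 6 * α) / (48 * α)) (Set.Iic α) α := by
    refine (hasDerivAt_lower hα).hasDerivWithinAt.congr_of_eventuallyEq_of_mem ?_ Set.self_mem_Iic
    filter_upwards [self_mem_nhdsWithin, mem_nhdsWithin_of_mem_nhds (Ioi_mem_nhds hα)]
      with a ha ha' using linearUtility_of_le ha' ha
  have hupp : HasDerivWithinAt (fun a => linearUtility a α)
      ((5 - 8 * α - 6 * α) / (48 * α)) (Set.Ici α) α := by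
    have heq : (2 * α ^ 2 + 3 * α * α - 2 * α * α ^ 2 - 12 * α ^ 3) / (48 * α ^ 3) =
        (5 - 8 * α - 6 * α) / (48 * α) := by
      field_simp
      ring
    rw [← heq]
    refine (hasDerivAt_upper hα).hasDerivWithinAt.congr_of_eventuallyEq_of_mem ?_ Set.self_mem_Ici
    filter_upwards [self_mem_nhdsWithin] with a ha
    exact linearUtility_of_ge (hα.trans_le ha) ha
  have hd := hlow.union hupp
  rw [Set.Iic_union_Ici, hasDerivWithinAt_univ] at hd
  have h0 := (isLocalMax_of_bestResponse hα h).hasDerivAt_eq_zero hd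
  rw [div_eq_zero_iff] at h0
  rcases h0 with h0 | h0 <;> linarith

theorem not_lt_of_bestResponses (hα : 0 < α)
    (h1 : ∀ a, 0 ≤ a → linearUtility a β ≤ linearUtility α β)
    (h2 : ∀ a, 0 ≤ a → linearUtility a α ≤ linearUtility β α) : ¬ α < β := by
  intro hαβ
  have e1 := eq_of_bestResponse_of_lt hα hαβ h1
  have e2 := eq_of_bestResponse_of_gt hα hαβ h2
  have hβ := hα.trans hαβ
  -- The condition `e1` replaces the constant `5` by `8 * α + 6 * β` and makes `e2` homogeneous.
  -- Since `16 + 26 + 18 = 60`, the right side is smaller than the left when `α < β`.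
  have e3 : 60 * β ^ 3 = 16 * α ^ 3 + 26 * α ^ 2 * β + 18 * α * β ^ 2 := by
    linear_combination 5 * e2 - (2 * α ^ 2 + 3 * β * α) * e1
  have i1 : α ^ 2 < β ^ 2 := by gcongr
  have i2 : α ^ 3 < β ^ 3 := by gcongr
  have i3 : α ^ 2 * β < β ^ 2 * β := by gcongr
  have i4 : α * β ^ 2 < β * β ^ 2 := by gcongr
  nlinarith

theorem linearUtility_le_equilibrium (a : ℝ) (ha : 0 ≤ a) :
    linearUtility a (5 / 14) ≤ linearUtility (5 / 14) (5 / 14) := by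
  rw [linearUtility_of_le (by norm_num) le_rfl]
  rcases ha.eq_or_lt with rfl | ha
  · rw [linearUtility, if_pos rfl]; norm_num
  rcases le_total a (5 / 14) with h | h
  · rw [linearUtility_of_le ha h, ← sub_nonneg]
    -- On each branch the loss has a double zero at `5 / 14`; factoring it out leaves a positive
    -- cofactor.
    have : 0 ≤ 7 / 30 * (a - 5 / 14) ^ 2 := by positivity
    refine this.trans_eq ?_
    ring
  · rw [linearUtility_of_ge ha h, ← sub_nonneg]
    have : 0 ≤ (a - 5 / 14) ^ 2 * (a + 1 / 12) / (4 * a ^ 2) := by positivity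
    refine this.trans_eq ?_
    field_simp
    ring

end BestResponse

/-! ### The unique equilibrium in linear strategies -/

theorem isNashEquilibrium_linearShading_iff (B : Fin 2 → ℝ → ℝ) :
    IsNashEquilibrium linearShading B ↔ ∀ i, B i = fun v => 5 / 14 * v := by
  constructor
  · rintro ⟨hmem, hopt⟩
    choose α hα hB using hmem
    have hbest : ∀ i j, i ≠ j → ∀ a, 0 ≤ a →
        linearUtility a (α j) ≤ linearUtility (α i) (α j) := by
      intro i j hij a ha
      have h := hopt i (fun v => a * v) ⟨a, ha, rfl⟩
      rwa [utility_linear hij ha (hα j) (fun v => by rw [Function.update_self])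
          (fun v => by rw [Function.update_of_ne hij.symm, hB j]),
        utility_linear hij (hα i) (hα j) (fun v => by rw [hB i]) (fun v => by rw [hB j])] at h
    have h01 := hbest 0 1 (by decide)
    have h10 := hbest 1 0 (by decide)
    have p1 := pos_of_bestResponse (hα 0) (hα 1) h01
    have p0 := pos_of_bestResponse (hα 1) (hα 0) h10
    have heq : α 0 = α 1 := le_antisymm
      (not_lt.1 (not_lt_of_bestResponses p1 h10 h01)) (not_lt.1 (not_lt_of_bestResponses p0 h01 h10))
    have e1 : α 1 = 5 / 14 := eq_of_bestResponse_self p1 fun a ha => by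
      have := h01 a ha
      rwa [heq] at this
    intro i
    have : α i = 5 / 14 := by
      rcases Fin.exists_fin_two.1 ⟨i, rfl⟩ with h | h
      · rw [h, heq, e1]
      · rw [h, e1]
    rw [hB i, this]
  · intro hB
    refine ⟨fun i => ⟨5 / 14, by norm_num, hB i⟩, ?_⟩
    rintro i _ ⟨a, ha, rfl⟩
    obtain ⟨j, hij⟩ : ∃ j, i ≠ j := ⟨i + 1, by omega⟩
    rw [utility_linear hij ha (by norm_num : (0 : ℝ) ≤ 5 / 14)
        (fun v => by rw [Function.update_self])
        (fun v => by rw [Function.update_of_ne hij.symm, hB j]),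
      utility_linear hij (by norm_num : (0 : ℝ) ≤ 5 / 14) (by norm_num : (0 : ℝ) ≤ 5 / 14)
        (fun v => by rw [hB i]) (fun v => by rw [hB j])]
    exact linearUtility_le_equilibrium a ha

end InducedAuction

theorem theorem2p2 :
    (∀ B : Fin 2 → ℝ → ℝ,
      InducedAuction.IsNashEquilibrium InducedAuction.linearShading B ↔
        ∀ i, B i = fun v => 5 / 14 * v) ∧
    InducedAuction.IsNashEquilibrium InducedAuction.monotoneStrategies
      (fun (_ : Fin 2) (v : ℝ) => (v + 1) / 4) :=
  ⟨InducedAuction.isNashEquilibrium_linearShading_iff,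
    InducedAuction.isNashEquilibrium_monotoneStrategies⟩
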